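/- Let $F$ be a (real) order continuous Banach lattice, i.e. every net in $F$ that decreases to $0$ in order converges to $0$ in norm, and let $E\subset F$ be a closed linear subspace. Then there is a weakest Hausdorff order continuous locally solid linear topology on $F$, denoted $\tau_F$ (a linear topology is locally solid if $0$ has a base of solid neighborhoods, and order continuous if every net that decreases to $0$ in order converges to $0$ in it), and the following conditions are equivalent: (i) $E$ is dispersed, i.e. there are no sequence $(e_k)_{k\in\mathbb{N}}$ in $E$ with $\|e_k\|=1$ for all $k$ and pairwise disjoint sequence $(f_k)_{k\in\mathbb{N}}$ in $F$ such that $\|f_k-e_k\|\to 0$; (ii) $E$ is $n$-dispersed for some integer $n\ge 2$, i.e. there are $n\ge 2$ and $r>0$ such that there are no pairwise disjoint $f_1,\dots,f_n\in F$ with $\|f_k\|=1$ and $\mathrm{dist}(f_k,E)<r$ for every $k=1,\dots,n$; (iii) $\tau_F$ agrees with the norm topology on $E$, i.e. both induce the same topology on $E$; (iv) $\tau_F$ agrees with the norm topology on sequences in $E$, i.e. for all $e_k, x\in E$ one has $e_k\to x$ in $\tau_F$ if and only if $\|e_k-x\|\to 0$. Here $f,g\in F$ are disjoint if $|f|\wedge|g|=0$.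 -/

import Mathlib

open Filter Topology

universe u

section VectorLattice

variable {F : Type u} [AddCommGroup F] [Lattice F]

/-- A topology on a vector lattice is order continuous if every net which decreases to zero
(in order) converges to zero in the topology. -/
def IsOrderContinuousTopology (t : TopologicalSpace F) : Prop :=
  ∀ (P : Type u) [Preorder P] [IsDirected P (· ≤ ·)] [Nonempty P] (f : P → F),
    Antitone f → IsGLB (Set.range f) 0 → Tendsto f atTop (𝓝 0)

/-- A linear topology on a vector lattice is locally solid if zero has a base of solid
neighborhoods. -/
structure IsLocallySolidTopology [Module ℝ F] (t : TopologicalSpace F) : Prop where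
  isTopologicalAddGroup : IsTopologicalAddGroup F
  continuousSMul : ContinuousSMul ℝ F
  exists_solid : ∀ U ∈ 𝓝 (0 : F), ∃ V ∈ 𝓝 (0 : F),
    V ⊆ U ∧ LatticeOrderedAddCommGroup.IsSolid V

variable (F) in
/-- The Hausdorff order continuous locally solid linear topologies on `F`. -/
def hausdorffOrderContinuousTopologies [Module ℝ F] : Set (TopologicalSpace F) :=
  {t | T2Space F ∧ IsOrderContinuousTopology t ∧ IsLocallySolidTopology t}

variable (F) in
/-- The topology `τ_F`: the weakest Hausdorff order continuous locally solid topology on `F`,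
whenever there is one. In the order on `TopologicalSpace F` one has `s ≤ t` when `t` is weaker
than `s`, so that the weakest element of a set of topologies is its greatest element, and is then
equal to its supremum. -/
def tauTopology [Module ℝ F] : TopologicalSpace F :=
  sSup (hausdorffOrderContinuousTopologies F)

/-- A family of elements is disjoint if `|f i| ⊓ |f j| = 0` whenever `i ≠ j`. -/
def IsDisjointFamily {ι : Type*} (f : ι → F) : Prop :=
  Pairwise fun i j => |f i| ⊓ |f j| = 0

end VectorLattice

section BanachLattice

variable {F : Type u} [NormedAddCommGroup F] [NormedSpace ℝ F] [Lattice F]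

/-- `E` is dispersed if it does not contain an almost disjoint sequence: there are no normalized
sequence `e` in `E` and disjoint sequence `f` in `F` with `‖f n - e n‖ → 0`. -/
def IsDispersed (E : Submodule ℝ F) : Prop :=
  ¬ ∃ e f : ℕ → F, (∀ n, e n ∈ E) ∧ (∀ n, ‖e n‖ = 1) ∧ IsDisjointFamily f ∧
    Tendsto (fun n => ‖f n - e n‖) atTop (𝓝 0)

/-- `E` is `n`-dispersed if, for some `r > 0`, there is no disjoint `n`-tuple of normalized
elements of `F` which are all at distance less than `r` from `E`. -/
def IsNDispersed (n : ℕ) (E : Submodule ℝ F) : Prop :=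
  ∃ r : ℝ, 0 < r ∧ ¬ ∃ f : Fin n → F, IsDisjointFamily f ∧ (∀ k, ‖f k‖ = 1) ∧
    ∀ k, Metric.infDist (f k) (E : Set F) < r

/-- The topology `t` and the norm topology induce the same topology on `E`. -/
def AgreesWithNormOn (t : TopologicalSpace F) (E : Submodule ℝ F) : Prop :=
  TopologicalSpace.induced ((↑) : E → F) t =
    TopologicalSpace.induced ((↑) : E → F) UniformSpace.toTopologicalSpace

/-- The topology `t` and the norm topology have the same convergent sequences, with the same
limits, in `E`. -/
def AgreesWithNormOnSequences (t : TopologicalSpace F) (E : Submodule ℝ F) : Prop :=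
  ∀ (e : ℕ → E) (x : E),
    Tendsto (fun n => (e n : F)) atTop (@nhds F t x) ↔
      Tendsto (fun n => ‖(e n : F) - x‖) atTop (𝓝 0)

end BanachLattice

/-!
Throughout, `F` is a Banach lattice with order continuous norm. The topology `τ_F` is the unbounded
norm topology, with the sets `{f | ‖|f| ⊓ u‖ < ε}` (`u ≥ 0`, `ε > 0`) as a base at zero.

It is the weakest Hausdorff order continuous locally solid topology because every such topology `t`
is at least as strong as the norm on order intervals `[0, u]` (`exists_nhds_forall_norm_lt`). For a
sequence of solid `t`-neighborhoods `U n` with `U (n + 1) + U (n + 1) ⊆ U n`, the kernel `⋂ n, U n`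
meets `[0, u]` in a set with a greatest element. These greatest elements decrease to zero as the
sequence of neighborhoods varies, so one of them has small norm, and then the elements of
`U n ∩ [0, u]` have small norm for some `n`: the order limit superior of counterexamples would lie
in the kernel. Suprema exist since `F` is Dedekind complete (`exists_isLUB_of_directedOn`).

The equivalences rest on two facts.

* On `[0, u]` the norm is controlled by one positive functional (`exists_control_functional`).
  Values of a positive functional on disjoint elements of `[0, u]` add up to at most its value at
  `u`, so that in a long disjoint family some member has small infimum with `u` in norm
  (`exists_norm_abs_inf_lt`). Hence disjoint sequences are `τ_F`-null, and if `E` is not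
  `n`-dispersed for any `n`, then every `τ_F`-neighborhood of zero contains elements of `E` of norm
  at least `1 / 2`.
* By the Kadec–Pełczyński procedure (`not_isDispersed_of_forall_exists`), if every
  `τ_F`-neighborhood of zero contains elements of `E` of norm bounded below, then `E` contains an
  almost disjoint normalized sequence, that is, `E` is not dispersed.

The first fact shows that agreement of `τ_F` and the norm on sequences in `E` makes `E` dispersed.
The second shows that a dispersed `E` is `n`-dispersed for some `n`, and that `τ_F` and the norm
agree on it.
-/

/-! ### Lattice-ordered groups and vector lattices -/

section LatticeGroup

variable {F : Type*} [AddCommGroup F] [Lattice F] [IsOrderedAddMonoid F]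

lemma inf_add_le_inf_add_inf {a b c : F} (ha : 0 ≤ a) (hb : 0 ≤ b) (hc : 0 ≤ c) :
    a ⊓ (b + c) ≤ a ⊓ b + a ⊓ c := by
  rw [add_inf, inf_add, inf_add]
  refine le_inf (le_inf ?_ ?_) (le_inf ?_ ?_)
  · exact inf_le_left.trans (le_add_of_nonneg_left ha)
  · exact inf_le_left.trans (le_add_of_nonneg_left hb)
  · exact inf_le_left.trans (le_add_of_nonneg_right hc)
  · exact inf_le_right

lemma sum_le_of_disjoint {ι : Type*} {x : ι → F} {u : F} (hx : ∀ i, 0 ≤ x i)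
    (hxu : ∀ i, x i ≤ u) (hu : 0 ≤ u) (hd : Pairwise fun i j => x i ⊓ x j = 0) (s : Finset ι) :
    ∑ i ∈ s, x i ≤ u := by
  classical
  have key : ∀ (s : Finset ι) (k : ι), k ∉ s → x k ⊓ ∑ i ∈ s, x i = 0 := by
    intro s
    induction s using Finset.induction_on with
    | empty => intro k _; simpa using hx k
    | insert a s ha ih =>
      intro k hk
      rw [Finset.mem_insert, not_or] at hk
      rw [Finset.sum_insert ha]
      refine le_antisymm ?_ (le_inf (hx k) (add_nonneg (hx a) (Finset.sum_nonneg fun i _ => hx i)))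
      refine (inf_add_le_inf_add_inf (hx k) (hx a) (Finset.sum_nonneg fun i _ => hx i)).trans ?_
      rw [hd hk.1, ih k hk.2, add_zero]
  induction s using Finset.induction_on with
  | empty => simpa using hu
  | insert a s ha ih =>
    rw [Finset.sum_insert ha, ← inf_add_sup (x a), key s a ha, zero_add]
    exact sup_le (hxu a) ih

lemma partialSups_le_sum {x : ℕ → F} (hx : ∀ i, 0 ≤ x i) (n : ℕ) :
    partialSups x n ≤ ∑ i ∈ Finset.range (n + 1), x i :=
  partialSups_le _ _ _ fun _ hj =>
    Finset.single_le_sum (f := x) (fun i _ => hx i) (Finset.mem_range.2 (Nat.lt_succ_of_le hj))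

lemma abs_sub_le_of_nonneg_of_le_right {a b c : F} (ha : 0 ≤ a) (hb : 0 ≤ b) (hac : a ≤ c)
    (hbc : b ≤ c) : |a - b| ≤ c :=
  abs_le'.2 ⟨(sub_le_self a hb).trans hac, by
    rw [neg_sub]; exact (sub_le_self b ha).trans hbc⟩

/-- Truncation: subtracting from `e` what `|e|` has below `a` leaves an element dominated by
`(|e| - a)⁺`. -/
lemma exists_abs_le_posPart_sub (e : F) {a : F} (ha : 0 ≤ a) :
    ∃ f : F, |f| ≤ (|e| - a)⁺ ∧ |f - e| ≤ |e| ⊓ a := by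
  have hp : e⁺ ≤ |e| := sup_le (le_abs_self e) (abs_nonneg e)
  have hn : e⁻ ≤ |e| := sup_le (neg_le_abs e) (abs_nonneg e)
  refine ⟨(e⁺ - a)⁺ - (e⁻ - a)⁺, ?_, ?_⟩
  · exact abs_sub_le_of_nonneg_of_le_right (posPart_nonneg _) (posPart_nonneg _)
      (posPart_mono (sub_le_sub_right hp a)) (posPart_mono (sub_le_sub_right hn a))
  · have h : (e⁺ - a)⁺ - (e⁻ - a)⁺ - e = e⁻ ⊓ a - e⁺ ⊓ a := by
      rw [inf_eq_sub_posPart_sub, inf_eq_sub_posPart_sub]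
      nth_rewrite 3 [← posPart_sub_negPart e]
      abel
    rw [h]
    exact abs_sub_le_of_nonneg_of_le_right (le_inf (negPart_nonneg e) ha)
      (le_inf (posPart_nonneg e) ha) (inf_le_inf_right a hn) (inf_le_inf_right a hp)

lemma abs_inf_abs_eq_zero_of_le {f g a b : F} (hf : |f| ≤ a) (hg : |g| ≤ b) (h : a ⊓ b ≤ 0) :
    |f| ⊓ |g| = 0 :=
  le_antisymm ((inf_le_inf hf hg).trans h) (le_inf (abs_nonneg f) (abs_nonneg g))

lemma abs_add_inf_le (f g : F) {u : F} (hu : 0 ≤ u) : |f + g| ⊓ u ≤ |f| ⊓ u + |g| ⊓ u := by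
  refine (inf_le_inf_right u (abs_add_le f g)).trans ?_
  rw [inf_comm, inf_comm |f|, inf_comm |g|]
  exact inf_add_le_inf_add_inf hu (abs_nonneg f) (abs_nonneg g)

variable [Module ℝ F] [IsOrderedModule ℝ F]

lemma abs_smul_of_nonneg {c : ℝ} (hc : 0 ≤ c) (x : F) : |c • x| = c • |x| := by
  rcases hc.eq_or_lt with rfl | hc
  · simp
  · have := (OrderIso.smulRight (β := F) hc).map_sup x (-x)
    rw [OrderIso.smulRight_apply, OrderIso.smulRight_apply, OrderIso.smulRight_apply] at this
    rw [abs, abs, this, smul_neg]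

lemma abs_smul_inf_le {c d : ℝ} (hc : |c| ≤ d) (hd : 1 ≤ d) (x : F) {u : F} (hu : 0 ≤ u) :
    |c • x| ⊓ u ≤ d • (|x| ⊓ u) := by
  have h1 : |c • x| = |c| • |x| := by
    rcases le_total 0 c with h | h
    · rw [abs_smul_of_nonneg h, abs_of_nonneg h]
    · rw [← abs_neg, ← neg_smul, abs_smul_of_nonneg (neg_nonneg.2 h), abs_of_nonpos h]
  have h2 := (OrderIso.smulRight (β := F) (zero_lt_one.trans_le hd)).map_inf |x| u
  simp only [OrderIso.smulRight_apply] at h2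
  rw [h2, h1]
  refine inf_le_inf (smul_le_smul_of_nonneg_right hc (abs_nonneg x)) ?_
  simpa using smul_le_smul_of_nonneg_right hd hu

lemma abs_smul_inf_abs_smul_eq_zero (c d : ℝ) {x y : F} (h : |x| ⊓ |y| = 0) :
    |c • x| ⊓ |d • y| = 0 := by
  have key : ∀ (c : ℝ) {x y : F}, |x| ⊓ |y| = 0 → |c • x| ⊓ |y| = 0 := fun c x y h => by
    refine le_antisymm ?_ (le_inf (abs_nonneg _) (abs_nonneg _))
    have := abs_smul_inf_le (le_max_left |c| 1) (le_max_right _ _) x (abs_nonneg y)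
    rwa [h, smul_zero] at this
  refine key c ?_
  rw [inf_comm] at h ⊢
  exact key d h

/-- The disjointness behind the Kadec–Pełczyński argument: with `z = x - c • y` the two elements
are dominated by `z⁺` and `z⁻`. -/
lemma posPart_sub_smul_inf_le_zero {x y : F} {c : ℝ} (hc : 1 ≤ c) :
    (x - c • y)⁺ ⊓ (y - c⁻¹ • x)⁺ ≤ 0 := by
  have hc0 : 0 < c := zero_lt_one.trans_le hc
  rw [← posPart_inf_negPart_eq_zero (x - c • y)]
  refine inf_le_inf_left _ (sup_le ?_ (negPart_nonneg _))
  calc y - c⁻¹ • x = c⁻¹ • -(x - c • y) := by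
        rw [neg_sub, smul_sub, smul_smul, inv_mul_cancel₀ hc0.ne', one_smul]
    _ ≤ c⁻¹ • (x - c • y)⁻ :=
        smul_le_smul_of_nonneg_left (neg_le_negPart _) (inv_nonneg.2 hc0.le)
    _ ≤ (1 : ℝ) • (x - c • y)⁻ :=
        smul_le_smul_of_nonneg_right (inv_le_one_of_one_le₀ hc) (negPart_nonneg _)
    _ = _ := one_smul _ _

end LatticeGroup

/-! ### Order continuity and Dedekind completeness -/

section OrderContinuous

variable {F : Type u} [AddCommGroup F] [Lattice F]

lemma IsOrderContinuousTopology.exists_mem_of_isGLB {t : TopologicalSpace F}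
    (ht : IsOrderContinuousTopology t) {D : Set F} (hne : D.Nonempty)
    (hD : DirectedOn (· ≥ ·) D) (h0 : IsGLB D 0) {V : Set F} (hV : V ∈ @nhds F t 0) :
    ∃ d ∈ D, d ∈ V := by
  let P := (D)ᵒᵈ
  have : Nonempty P := hne.to_subtype
  have : IsDirected P (· ≤ ·) := ⟨fun a b => by
    obtain ⟨c, hc, hca, hcb⟩ := hD a.1 a.2 b.1 b.2
    exact ⟨⟨c, hc⟩, hca, hcb⟩⟩
  have h := ht P (fun d => (d : D).1) (fun a b hab => hab) (by
    have : Set.range (fun d : P => (d : D).1) = D := Subtype.range_coe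
    rwa [this])
  obtain ⟨d, hd⟩ := (h.eventually hV).exists
  exact ⟨_, d.2, hd⟩

variable [IsOrderedAddMonoid F]

lemma IsOrderContinuousTopology.exists_sub_mem_of_isLUB {t : TopologicalSpace F}
    (ht : IsOrderContinuousTopology t) {D : Set F} (hne : D.Nonempty)
    (hD : DirectedOn (· ≤ ·) D) {y : F} (hy : IsLUB D y) {V : Set F} (hV : V ∈ @nhds F t 0) :
    ∃ d ∈ D, y - d ∈ V := by
  have := ht.exists_mem_of_isGLB (D := (fun d => y - d) '' D) (hne.image _) ?_ ?_ hV
  · simpa using this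
  · rintro _ ⟨a, ha, rfl⟩ _ ⟨b, hb, rfl⟩
    obtain ⟨c, hc, hac, hbc⟩ := hD a ha b hb
    exact ⟨_, ⟨c, hc, rfl⟩, sub_le_sub_left hac y, sub_le_sub_left hbc y⟩
  · refine ⟨?_, fun z hz => ?_⟩
    · rintro _ ⟨a, ha, rfl⟩
      exact sub_nonneg.2 (hy.1 ha)
    · have : y ≤ y - z := hy.2 fun d hd => le_sub_comm.1 (hz ⟨d, hd, rfl⟩)
      simpa using this

end OrderContinuous

section BanachLattice

variable {F : Type u} [NormedAddCommGroup F] [Lattice F] [IsOrderedAddMonoid F] [HasSolidNorm F]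

lemma norm_le_norm_of_nonneg_of_le {a b : F} (ha : 0 ≤ a) (hab : a ≤ b) : ‖a‖ ≤ ‖b‖ :=
  norm_le_norm_of_abs_le_abs (abs_le_abs_of_nonneg ha hab)


variable [NormedSpace ℝ F] [IsOrderedModule ℝ F]

/-- The norm of a Banach lattice makes it Archimedean. -/
lemma nonpos_of_forall_nsmul_le {z c : F} (h : ∀ n : ℕ, n • z ≤ c) : z ≤ 0 := by
  have h1 : ∀ n : ℕ, z ≤ (1 / ((n : ℝ) + 1)) • c := fun n => by
    have h2 := smul_le_smul_of_nonneg_left (h (n + 1))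
      (a := 1 / ((n : ℝ) + 1)) (by positivity)
    rwa [← Nat.cast_smul_eq_nsmul ℝ, smul_smul, Nat.cast_add_one, one_div,
      inv_mul_cancel₀ (by positivity), one_smul, ← one_div] at h2
  have h2 : Tendsto (fun n : ℕ => (1 / ((n : ℝ) + 1)) • c) atTop (𝓝 0) := by
    simpa using (tendsto_one_div_add_atTop_nhds_zero_nat (𝕜 := ℝ)).smul_const c
  exact ge_of_tendsto' h2 h1

variable [CompleteSpace F]

/-- A Banach lattice with order continuous norm is Dedekind complete: the differences of upper
bounds and members of a bounded upwards directed set decrease to `0`, so that the set is a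
Cauchy net. -/
lemma exists_isLUB_of_directedOn
    (hF : IsOrderContinuousTopology (UniformSpace.toTopologicalSpace : TopologicalSpace F))
    {D : Set F} (hne : D.Nonempty) (hD : DirectedOn (· ≤ ·) D) (hb : BddAbove D) :
    ∃ y, IsLUB D y := by
  have hclose : ∀ ε > 0, ∃ b ∈ upperBounds D, ∃ d ∈ D, ‖b - d‖ < ε := by
    intro ε hε
    suffices h : ∃ z ∈ {z | ∃ b ∈ upperBounds D, ∃ d ∈ D, b - d = z}, z ∈ Metric.ball (0 : F) ε by
      obtain ⟨_, ⟨b, hb, d, hd, rfl⟩, h⟩ := h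
      exact ⟨b, hb, d, hd, mem_ball_zero_iff.1 h⟩
    refine hF.exists_mem_of_isGLB ?_ ?_ ?_ (Metric.ball_mem_nhds 0 hε)
    · obtain ⟨b, hb⟩ := hb
      obtain ⟨d, hd⟩ := hne
      exact ⟨_, b, hb, d, hd, rfl⟩
    · rintro _ ⟨b, hb, d, hd, rfl⟩ _ ⟨b', hb', d', hd', rfl⟩
      obtain ⟨c, hc, hdc, hdc'⟩ := hD d hd d' hd'
      exact ⟨_, ⟨b ⊓ b', fun x hx => le_inf (hb hx) (hb' hx), c, hc, rfl⟩,
        sub_le_sub inf_le_left hdc, sub_le_sub inf_le_right hdc'⟩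
    · refine ⟨?_, fun z hz => ?_⟩
      · rintro _ ⟨b, hb, d, hd, rfl⟩
        exact sub_nonneg.2 (hb hd)
      · obtain ⟨b, hb⟩ := hb
        obtain ⟨d, hd⟩ := hne
        -- subtracting a lower bound `z` from an upper bound of `D` gives an upper bound again
        have hn : ∀ n : ℕ, b - n • z ∈ upperBounds D := by
          intro n
          induction n with
          | zero => simpa using hb
          | succ n ih =>
            intro x hx
            have := hz ⟨_, ih, x, hx, rfl⟩
            rw [succ_nsmul, ← sub_sub]
            exact le_sub_comm.1 this
        exact nonpos_of_forall_nsmul_le (c := b - d) fun n => le_sub_comm.1 (hn n hd)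
  choose b hbD d hdD hbd using fun n : ℕ => hclose (1 / ((n : ℝ) + 1)) (by positivity)
  have hlim := tendsto_one_div_add_atTop_nhds_zero_nat (𝕜 := ℝ)
  have hle : ∀ n, ∀ x ∈ D, d n ≤ x → ‖x - d n‖ ≤ 1 / ((n : ℝ) + 1) := fun n x hx hdx =>
    (norm_le_norm_of_nonneg_of_le (sub_nonneg.2 hdx) (sub_le_sub_right (hbD n hx) _)).trans
      (hbd n).le
  have hcau : CauchySeq d := by
    refine Metric.cauchySeq_iff.2 fun ε hε => ?_
    obtain ⟨N, hN⟩ := eventually_atTop.1 (hlim.eventually (gt_mem_nhds (half_pos hε)))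
    refine ⟨N, fun m hm n hn => ?_⟩
    obtain ⟨x, hx, hmx, hnx⟩ := hD _ (hdD m) _ (hdD n)
    have h1 := (hle m x hx hmx).trans_lt (hN m hm)
    have h2 := (hle n x hx hnx).trans_lt (hN n hn)
    calc dist (d m) (d n) ≤ dist x (d m) + dist x (d n) := dist_triangle_left _ _ _
      _ < ε / 2 + ε / 2 := by rw [dist_eq_norm, dist_eq_norm]; exact add_lt_add h1 h2
      _ = ε := add_halves ε
  obtain ⟨y, hy⟩ := cauchySeq_tendsto_of_complete hcau
  have hby : Tendsto b atTop (𝓝 y) := by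
    have h0 : Tendsto (fun n => b n - d n) atTop (𝓝 0) :=
      squeeze_zero_norm (fun n => (hbd n).le) hlim
    simpa using h0.add hy
  exact ⟨y, fun x hx => ge_of_tendsto' hby fun n => hbD n hx,
    fun c hc => le_of_tendsto' hy fun n => hc (hdD n)⟩

/-- The order limit superior of an order bounded sequence: the suprema `y m` of its tails
converge in norm to `z = inf y`. -/
lemma exists_limsup
    (hF : IsOrderContinuousTopology (UniformSpace.toTopologicalSpace : TopologicalSpace F))
    {x : ℕ → F} {u : F} (hx : ∀ n, 0 ≤ x n) (hxu : ∀ n, x n ≤ u) :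
    ∃ (y : ℕ → F) (z : F), (∀ m, IsLUB (Set.range (partialSups fun i => x (m + i))) (y m)) ∧
      (∀ m, x m ≤ y m) ∧ (∀ m, y m ≤ u) ∧ 0 ≤ z ∧ (∀ m, z ≤ y m) ∧
      ∀ ε > 0, ∃ N, ∀ m ≥ N, ‖y m - z‖ < ε := by
  have hdir : ∀ m, DirectedOn (· ≤ ·) (Set.range (partialSups fun i => x (m + i))) := fun m =>
    (partialSups_monotone _).directed_le.directedOn_range
  have hub : ∀ m, u ∈ upperBounds (Set.range (partialSups fun i => x (m + i))) := by
    rintro m _ ⟨n, rfl⟩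
    exact partialSups_le _ _ _ fun j _ => hxu _
  choose y hy using fun m => exists_isLUB_of_directedOn hF (Set.range_nonempty _) (hdir m)
    ⟨u, hub m⟩
  have hxy : ∀ m k, m ≤ k → x k ≤ y m := fun m k hmk => by
    obtain ⟨i, rfl⟩ := Nat.exists_eq_add_of_le hmk
    exact (le_partialSups (fun i => x (m + i)) i).trans ((hy m).1 ⟨i, rfl⟩)
  have hanti : Antitone y := fun m k hmk => (hy k).2 (by
    rintro _ ⟨n, rfl⟩
    exact partialSups_le _ _ _ fun j _ => hxy _ _ (hmk.trans (Nat.le_add_right _ _)))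
  have hdir' : DirectedOn (· ≤ ·) (Set.range fun m => -y m) :=
    (Monotone.directed_le fun m k h => neg_le_neg (hanti h)).directedOn_range
  obtain ⟨w, hw⟩ := exists_isLUB_of_directedOn hF (Set.range_nonempty (fun m => -y m)) hdir'
    ⟨0, by rintro _ ⟨m, rfl⟩; exact neg_nonpos.2 ((hx m).trans (hxy m m le_rfl))⟩
  have hwy : ∀ m, -w ≤ y m := fun m => neg_le.1 (hw.1 ⟨m, rfl⟩)
  refine ⟨y, -w, hy, fun m => hxy m m le_rfl, fun m => (hy m).2 (hub m), ?_, hwy, ?_⟩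
  · exact neg_nonneg.2 (hw.2 (by
      rintro _ ⟨m, rfl⟩; exact neg_nonpos.2 ((hx m).trans (hxy m m le_rfl))))
  · intro ε hε
    obtain ⟨_, ⟨N, rfl⟩, hN⟩ := hF.exists_sub_mem_of_isLUB (Set.range_nonempty _) hdir' hw
      (Metric.ball_mem_nhds 0 hε)
    refine ⟨N, fun m hm => ?_⟩
    rw [mem_ball_zero_iff, sub_neg_eq_add, add_comm, ← sub_neg_eq_add] at hN
    exact (norm_le_norm_of_nonneg_of_le (sub_nonneg.2 (hwy m))
      (sub_le_sub_right (hanti hm) _)).trans_lt hN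

end BanachLattice

/-! ### Control functionals and disjoint families in order intervals -/

section Functional

variable {F : Type u} [NormedAddCommGroup F] [NormedSpace ℝ F]
    [Lattice F] [IsOrderedAddMonoid F] [IsOrderedModule ℝ F] [HasSolidNorm F]

/-- A positive element is normed by a positive functional of norm at most one. The bound by
`‖z⁺‖` encodes both positivity and contractivity. -/
lemma exists_positive_norming {x : F} (hx : 0 ≤ x) :
    ∃ φ : F →ₗ[ℝ] ℝ, (∀ z, φ z ≤ ‖z⁺‖) ∧ φ x = ‖x‖ := by
  have hsub : ∀ z w : F, ‖(z + w)⁺‖ ≤ ‖z⁺‖ + ‖w⁺‖ := fun z w =>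
    (norm_le_norm_of_nonneg_of_le (posPart_nonneg _)
      (sup_le (add_le_add (le_posPart z) (le_posPart w))
        (add_nonneg (posPart_nonneg z) (posPart_nonneg w)))).trans (norm_add_le _ _)
  have hhom : ∀ c : ℝ, 0 < c → ∀ z : F, ‖(c • z)⁺‖ = c * ‖z⁺‖ := fun c hc z => by
    have h := (OrderIso.smulRight (β := F) hc).map_sup z 0
    rw [OrderIso.smulRight_apply, OrderIso.smulRight_apply, OrderIso.smulRight_apply,
      smul_zero] at h
    rw [posPart_def, posPart_def, ← h, norm_smul, Real.norm_of_nonneg hc.le]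
  rcases eq_or_ne x 0 with rfl | hx0
  · exact ⟨0, fun z => by simp, by simp⟩
  let f : F →ₗ.[ℝ] ℝ := LinearPMap.mkSpanSingleton x ‖x‖ hx0
  obtain ⟨φ, hφ, hφN⟩ := exists_extension_of_le_sublinear f (fun z => ‖z⁺‖) hhom hsub (by
    rintro ⟨z, hz⟩
    obtain ⟨c, rfl⟩ := Submodule.mem_span_singleton.1 hz
    rw [LinearPMap.mkSpanSingleton'_apply]
    rcases le_or_gt c 0 with hc | hc
    · exact (smul_nonpos_of_nonpos_of_nonneg hc (norm_nonneg x)).trans (norm_nonneg _)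
    · change c • ‖x‖ ≤ ‖(c • x)⁺‖
      rw [hhom c hc, posPart_of_nonneg hx, smul_eq_mul])
  exact ⟨φ, hφN, (hφ ⟨x, Submodule.mem_span_singleton_self x⟩).trans
    (LinearPMap.mkSpanSingleton_apply ℝ ℝ hx0 ‖x‖)⟩

variable [CompleteSpace F]

/-- On an order interval `[0, u]` the norm is controlled by a single positive functional.
Otherwise there are norming functionals `φ n` of elements `x n` in `[0, u]` of large norm such that
`φ i (x n) < 2⁻ⁿ` for `i < n`. The order limit superior of the `x n` is then annihilated by all
`φ i`, although the suprema of the tails converge to it in norm and satisfy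
`φ n (sup_{k ≥ n} x k) ≥ φ n (x n) = ‖x n‖`. -/
lemma exists_control_functional
    (hF : IsOrderContinuousTopology (UniformSpace.toTopologicalSpace : TopologicalSpace F))
    (u : F) {ε : ℝ} (hε : 0 < ε) :
    ∃ φ : F →ₗ[ℝ] ℝ, (∀ z, 0 ≤ z → 0 ≤ φ z) ∧
      ∃ η > 0, ∀ x, 0 ≤ x → x ≤ u → φ x < η → ‖x‖ < ε := by
  by_contra! H
  let P := {φ : F →ₗ[ℝ] ℝ // ∀ z, 0 ≤ z → 0 ≤ φ z}
  have H' : ∀ (φ : P) (n : ℕ), ∃ x, 0 ≤ x ∧ x ≤ u ∧ φ.1 x < (1 / 2) ^ n ∧ ε ≤ ‖x‖ :=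
    fun φ n => H φ.1 φ.2 _ (by positivity)
  choose X hX0 hXu hXφ hXε using H'
  choose Φ hΦ hΦX using fun x : {x : F // 0 ≤ x} => exists_positive_norming x.2
  have hΦpos : ∀ x z, 0 ≤ z → 0 ≤ Φ x z := fun x z hz => by
    have := hΦ x (-z)
    rw [posPart_of_nonpos (neg_nonpos.2 hz), norm_zero, map_neg] at this
    exact neg_nonpos.1 this
  have hΦle : ∀ x z, 0 ≤ z → Φ x z ≤ ‖z‖ := fun x z hz => by
    simpa [posPart_of_nonneg hz] using hΦ x z
  -- `S n` is the sum of the functionals `φ i` with `i < n`, where `x n` is chosen for `S n`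
  let S : ℕ → P := fun n => Nat.rec ⟨0, fun _ _ => le_rfl⟩
    (fun n T => ⟨T.1 + Φ ⟨X T n, hX0 T n⟩, fun z hz => add_nonneg (T.2 z hz) (hΦpos _ z hz)⟩) n
  let x : ℕ → F := fun n => X (S n) n
  let φ : ℕ → F →ₗ[ℝ] ℝ := fun n => Φ ⟨x n, hX0 _ _⟩
  have hS : ∀ n, (S (n + 1)).1 = (S n).1 + φ n := fun n => rfl
  have hφS : ∀ i n, i < n → ∀ z, 0 ≤ z → φ i z ≤ (S n).1 z := by
    intro i n hin z hz
    induction n, hin using Nat.le_induction with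
    | base => rw [hS, LinearMap.add_apply]; exact le_add_of_nonneg_left ((S i).2 z hz)
    | succ n _ ih =>
      rw [hS, LinearMap.add_apply]
      exact ih.trans (le_add_of_nonneg_right (hΦpos _ z hz))
  have hφx : ∀ i n, i < n → φ i (x n) ≤ (1 / 2) ^ n := fun i n hin =>
    (hφS i n hin _ (hX0 _ _)).trans (hXφ _ _).le
  have hmono : ∀ i {a b : F}, a ≤ b → φ i a ≤ φ i b := fun i a b hab => by
    have := hΦpos ⟨x i, hX0 _ _⟩ (b - a) (sub_nonneg.2 hab)
    rw [map_sub] at this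
    exact sub_nonneg.1 this
  obtain ⟨y, z, hy, hxy, -, hz0, hzy, hlim⟩ := exists_limsup hF
    (x := x) (fun n => hX0 _ _) (fun n => hXu _ _)
  have htail : ∀ i m, i < m → φ i (y m) ≤ 2 * (1 / 2) ^ m := by
    intro i m him
    refine le_of_forall_pos_le_add fun δ hδ => ?_
    obtain ⟨_, ⟨n, rfl⟩, hn⟩ := hF.exists_sub_mem_of_isLUB (Set.range_nonempty _)
      (partialSups_monotone _).directed_le.directedOn_range (hy m) (Metric.ball_mem_nhds 0 hδ)
    have h1 : φ i (y m - partialSups (fun i => x (m + i)) n) ≤ δ :=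
      (hΦle _ _ (sub_nonneg.2 ((hy m).1 ⟨n, rfl⟩))).trans (mem_ball_zero_iff.1 hn).le
    have h2 : φ i (partialSups (fun i => x (m + i)) n) ≤ 2 * (1 / 2) ^ m := by
      refine (hmono i (partialSups_le_sum (fun j => hX0 _ _) n)).trans ?_
      rw [map_sum]
      calc ∑ j ∈ Finset.range (n + 1), φ i (x (m + j))
          ≤ ∑ j ∈ Finset.range (n + 1), (1 / 2 : ℝ) ^ m * (1 / 2) ^ j :=
            Finset.sum_le_sum fun j _ => by
              rw [← pow_add]; exact hφx i (m + j) (him.trans_le (Nat.le_add_right _ _))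
        _ = (1 / 2) ^ m * ∑ j ∈ Finset.range (n + 1), (1 / 2 : ℝ) ^ j := by
            rw [Finset.mul_sum]
        _ ≤ (1 / 2) ^ m * 2 := by
            gcongr
            exact sum_geometric_two_le _
        _ = 2 * (1 / 2) ^ m := mul_comm _ _
    rw [map_sub] at h1
    linarith
  have hz : ∀ i, φ i z ≤ 0 := fun i => by
    have h0 : Tendsto (fun m : ℕ => 2 * (1 / 2 : ℝ) ^ m) atTop (𝓝 0) := by
      simpa using (tendsto_pow_atTop_nhds_zero_of_lt_one (r := (1 / 2 : ℝ))
        (by norm_num) (by norm_num)).const_mul 2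
    refine ge_of_tendsto h0 ?_
    filter_upwards [eventually_gt_atTop i] with m hm
    exact (hmono i (hzy m)).trans (htail i m hm)
  obtain ⟨N, hN⟩ := hlim ε hε
  have h1 : ε ≤ φ N (y N) := (hXε (S N) N).trans ((hΦX ⟨x N, hX0 _ _⟩).ge.trans (hmono N (hxy N)))
  have h2 : φ N (y N - z) ≤ ‖y N - z‖ := hΦle _ _ (sub_nonneg.2 (hzy N))
  rw [map_sub] at h2
  linarith [hN N le_rfl, hz N]

/-- Order intervals contain no long disjoint families of elements of large norm: the values of a
control functional on such a family sum up to at most its value at `u`. -/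
lemma exists_norm_abs_inf_lt
    (hF : IsOrderContinuousTopology (UniformSpace.toTopologicalSpace : TopologicalSpace F))
    {u : F} (hu : 0 ≤ u) {ε : ℝ} (hε : 0 < ε) :
    ∃ N : ℕ, 2 ≤ N ∧ ∀ f : Fin N → F, IsDisjointFamily f → ∃ k, ‖|f k| ⊓ u‖ < ε := by
  obtain ⟨φ, hφ, η, hη, hφη⟩ := exists_control_functional hF u hε
  obtain ⟨n, hn⟩ := exists_nat_gt (φ u / η)
  refine ⟨n + 2, by omega, fun f hf => ?_⟩
  have h0 : ∀ k, 0 ≤ |f k| ⊓ u := fun k => le_inf (abs_nonneg _) hu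
  have hsum := sum_le_of_disjoint h0 (fun k => inf_le_right) hu (fun i j hij =>
    le_antisymm ((inf_le_inf inf_le_left inf_le_left).trans (hf hij).le)
      (le_inf (h0 i) (h0 j))) Finset.univ
  by_contra! H
  have hge : ∀ k, η ≤ φ (|f k| ⊓ u) := fun k => by
    by_contra! hlt
    exact (hφη _ (h0 k) inf_le_right hlt).not_ge (H k)
  have h1 : φ (∑ k, |f k| ⊓ u) ≤ φ u := by
    have := hφ _ (sub_nonneg.2 hsum)
    rw [map_sub] at this
    exact sub_nonneg.1 this
  have h2 : ((n + 2 : ℕ) : ℝ) * η ≤ φ (∑ k, |f k| ⊓ u) := by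
    rw [map_sum]
    simpa using Finset.card_nsmul_le_sum Finset.univ _ η fun k _ => hge k
  rw [div_lt_iff₀ hη] at hn
  push_cast at h2
  nlinarith

/-- Disjoint sequences converge to zero in the unbounded norm topology. -/
lemma IsDisjointFamily.tendsto_norm_abs_inf
    (hF : IsOrderContinuousTopology (UniformSpace.toTopologicalSpace : TopologicalSpace F))
    {f : ℕ → F} (hf : IsDisjointFamily f) {u : F} (hu : 0 ≤ u) :
    Tendsto (fun n => ‖|f n| ⊓ u‖) atTop (𝓝 0) := by
  refine Metric.tendsto_atTop.2 fun ε hε => ?_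
  obtain ⟨N, -, hN⟩ := exists_norm_abs_inf_lt hF hu hε
  have hfin : {n | ε ≤ ‖|f n| ⊓ u‖}.Finite := by
    by_contra hinf
    let g := Set.Infinite.natEmbedding _ hinf
    obtain ⟨k, hk⟩ := hN (fun k => f (g k)) fun i j hij =>
      hf fun h => hij (Fin.ext (g.injective (Subtype.ext h)))
    exact hk.not_ge (g k).2
  obtain ⟨M, hM⟩ := hfin.bddAbove
  refine ⟨M + 1, fun n hn => ?_⟩
  rw [dist_zero_right, norm_norm]
  by_contra! h
  exact absurd (hM h) (by omega)

end Functional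

/-! ### The unbounded norm topology -/

section UnboundedNorm

variable (F : Type u) [NormedAddCommGroup F] [NormedSpace ℝ F]
    [Lattice F] [IsOrderedAddMonoid F] [IsOrderedModule ℝ F] [HasSolidNorm F]

/-- The sets `{f | ‖|f| ⊓ u‖ < ε}`, for `u ≥ 0` and `ε > 0`, form a base at zero of a linear
topology, the unbounded norm topology. -/
def unModuleFilterBasis : ModuleFilterBasis ℝ F where
  sets := {V | ∃ (u : F) (ε : ℝ), 0 ≤ u ∧ 0 < ε ∧ V = {f | ‖|f| ⊓ u‖ < ε}}
  nonempty := ⟨_, 0, 1, le_rfl, one_pos, rfl⟩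
  inter_sets := by
    rintro _ _ ⟨u, ε, hu, hε, rfl⟩ ⟨v, δ, hv, hδ, rfl⟩
    refine ⟨_, ⟨u ⊔ v, min ε δ, le_sup_of_le_left hu, lt_min hε hδ, rfl⟩, fun f hf => ⟨?_, ?_⟩⟩
    · exact (norm_le_norm_of_nonneg_of_le (le_inf (abs_nonneg f) hu)
        (inf_le_inf_left _ le_sup_left)).trans_lt (hf.trans_le (min_le_left _ _))
    · exact (norm_le_norm_of_nonneg_of_le (le_inf (abs_nonneg f) hv)
        (inf_le_inf_left _ le_sup_right)).trans_lt (hf.trans_le (min_le_right _ _))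
  zero' := by
    rintro _ ⟨u, ε, hu, hε, rfl⟩
    simpa [inf_eq_left.2 hu] using hε
  add' := by
    rintro _ ⟨u, ε, hu, hε, rfl⟩
    refine ⟨_, ⟨u, ε / 2, hu, half_pos hε, rfl⟩, ?_⟩
    rintro _ ⟨f, hf, g, hg, rfl⟩
    have hf' : ‖|f| ⊓ u‖ < ε / 2 := hf
    have hg' : ‖|g| ⊓ u‖ < ε / 2 := hg
    calc ‖|f + g| ⊓ u‖ ≤ ‖|f| ⊓ u + |g| ⊓ u‖ :=
          norm_le_norm_of_nonneg_of_le (le_inf (abs_nonneg _) hu) (abs_add_inf_le f g hu)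
      _ ≤ ‖|f| ⊓ u‖ + ‖|g| ⊓ u‖ := norm_add_le _ _
      _ < ε := by linarith
  neg' := by
    rintro _ ⟨u, ε, hu, hε, rfl⟩
    exact ⟨_, ⟨u, ε, hu, hε, rfl⟩, fun f hf => by simpa using hf⟩
  conj' := by
    rintro x _ ⟨u, ε, hu, hε, rfl⟩
    exact ⟨_, ⟨u, ε, hu, hε, rfl⟩, fun f hf => by simpa using hf⟩
  smul' := by
    rintro _ ⟨u, ε, hu, hε, rfl⟩
    refine ⟨Metric.ball 0 1, Metric.ball_mem_nhds 0 one_pos, _, ⟨u, ε, hu, hε, rfl⟩, ?_⟩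
    rintro _ ⟨c, hc, f, hf, rfl⟩
    rw [mem_ball_zero_iff, Real.norm_eq_abs] at hc
    have h := abs_smul_inf_le hc.le le_rfl f hu
    rw [one_smul] at h
    exact (norm_le_norm_of_nonneg_of_le (le_inf (abs_nonneg _) hu) h).trans_lt hf
  smul_left' := by
    rintro c _ ⟨u, ε, hu, hε, rfl⟩
    have hd : 0 < max |c| 1 := lt_max_of_lt_right one_pos
    refine ⟨_, ⟨u, ε / max |c| 1, hu, div_pos hε hd, rfl⟩, fun f hf => ?_⟩
    have hf' : ‖|f| ⊓ u‖ < ε / max |c| 1 := hf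
    have h := norm_le_norm_of_nonneg_of_le (le_inf (abs_nonneg _) hu)
      (abs_smul_inf_le (le_max_left |c| 1) (le_max_right _ _) f hu)
    rw [norm_smul, Real.norm_of_nonneg hd.le] at h
    rw [lt_div_iff₀' hd] at hf'
    exact h.trans_lt hf'
  smul_right' := by
    rintro f _ ⟨u, ε, hu, hε, rfl⟩
    have h : Tendsto (fun c : ℝ => ‖c • f‖) (𝓝 0) (𝓝 0) := by
      have : Continuous fun c : ℝ => ‖c • f‖ := by fun_prop
      simpa using this.tendsto 0
    filter_upwards [h.eventually (gt_mem_nhds hε)] with c hc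
    refine lt_of_le_of_lt ?_ hc
    rw [← norm_abs_eq_norm (c • f)]
    exact norm_le_norm_of_nonneg_of_le (le_inf (abs_nonneg _) hu) inf_le_left

/-- The unbounded norm topology of a normed lattice. -/
@[reducible] def unTopology : TopologicalSpace F := (unModuleFilterBasis F).topology

variable {F}

lemma mem_nhds_unTopology {x : F} {V : Set F} :
    V ∈ @nhds F (unTopology F) x ↔
      ∃ (u : F) (ε : ℝ), 0 ≤ u ∧ 0 < ε ∧ ∀ f, ‖|f - x| ⊓ u‖ < ε → f ∈ V := by
  rw [((unModuleFilterBasis F).toAddGroupFilterBasis.nhds_hasBasis x).mem_iff]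
  constructor
  · rintro ⟨_, ⟨u, ε, hu, hε, rfl⟩, h⟩
    exact ⟨u, ε, hu, hε, fun f hf => h ⟨f - x, hf, by simp⟩⟩
  · rintro ⟨u, ε, hu, hε, h⟩
    refine ⟨_, ⟨u, ε, hu, hε, rfl⟩, ?_⟩
    rintro _ ⟨f, hf, rfl⟩
    exact h _ (by simpa using hf)

lemma unTopology_nhds_le (x : F) : 𝓝 x ≤ @nhds F (unTopology F) x := by
  intro V hV
  obtain ⟨u, ε, hu, hε, h⟩ := mem_nhds_unTopology.1 hV
  filter_upwards [Metric.ball_mem_nhds x hε] with f hf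
  refine h f (lt_of_le_of_lt ?_ (mem_ball_iff_norm.1 hf))
  rw [← norm_abs_eq_norm (f - x)]
  exact norm_le_norm_of_nonneg_of_le (le_inf (abs_nonneg _) hu) inf_le_left

lemma tendsto_unTopology_iff {ι : Type*} {l : Filter ι} {f : ι → F} {x : F} :
    Tendsto f l (@nhds F (unTopology F) x) ↔
      ∀ u, 0 ≤ u → Tendsto (fun i => ‖|f i - x| ⊓ u‖) l (𝓝 0) := by
  constructor
  · intro h u hu
    refine Metric.tendsto_nhds.2 fun ε hε => ?_
    filter_upwards [h.eventually (mem_nhds_unTopology.2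
      ⟨u, ε, hu, hε, fun f hf => (hf : f ∈ {f | ‖|f - x| ⊓ u‖ < ε})⟩)] with i hi
    rwa [dist_zero_right, norm_norm]
  · intro h V hV
    obtain ⟨u, ε, hu, hε, hV⟩ := mem_nhds_unTopology.1 hV
    exact mem_map.2 (((h u hu).eventually (gt_mem_nhds hε)).mono fun i hi => hV _ hi)

lemma unTopology_mem_hausdorffOrderContinuousTopologies
    (hF : IsOrderContinuousTopology (UniformSpace.toTopologicalSpace : TopologicalSpace F)) :
    unTopology F ∈ hausdorffOrderContinuousTopologies F := by
  have hgrp : @IsTopologicalAddGroup F (unTopology F) _ :=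
    (unModuleFilterBasis F).toAddGroupFilterBasis.isTopologicalAddGroup
  refine ⟨?_, fun P _ _ _ f hf h0 => (hF P f hf h0).mono_right (unTopology_nhds_le 0), hgrp,
    (unModuleFilterBasis F).continuousSMul, fun U hU => ?_⟩
  · let _ := unTopology F
    refine IsTopologicalAddGroup.t2Space_of_zero_sep fun x hx => ?_
    refine ⟨{f | ‖|f| ⊓ |x|‖ < ‖x‖}, mem_nhds_unTopology.2 ⟨|x|, ‖x‖, abs_nonneg x,
      norm_pos_iff.2 hx, fun f hf => by simpa using hf⟩, fun h => ?_⟩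
    rw [Set.mem_ofPred_eq, inf_idem, norm_abs_eq_norm] at h
    exact h.false
  · obtain ⟨u, ε, hu, hε, hU⟩ := mem_nhds_unTopology.1 hU
    refine ⟨{f | ‖|f| ⊓ u‖ < ε}, mem_nhds_unTopology.2 ⟨u, ε, hu, hε, fun f hf => by
      simpa using hf⟩, fun f hf => hU f (by simpa using hf), fun f hf g hgf => ?_⟩
    exact (norm_le_norm_of_nonneg_of_le (le_inf (abs_nonneg _) hu)
      (inf_le_inf_right u hgf)).trans_lt hf

end UnboundedNorm

/-! ### Minimality of the unbounded norm topology -/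

section NormalSequence

variable {F : Type u} [AddCommGroup F] [Lattice F]

/-- A normal sequence of neighborhoods of zero of a locally solid topology: a sequence of solid
neighborhoods `U n` with `U (n + 1) + U (n + 1) ⊆ U n`. -/
structure IsNormalSequence (t : TopologicalSpace F) (U : ℕ → Set F) : Prop where
  mem_nhds : ∀ n, U n ∈ @nhds F t 0
  solid : ∀ n, LatticeOrderedAddCommGroup.IsSolid (U n)
  add_mem : ∀ n a b, a ∈ U (n + 1) → b ∈ U (n + 1) → a + b ∈ U n

lemma IsNormalSequence.inter {t : TopologicalSpace F} {U V : ℕ → Set F}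
    (hU : IsNormalSequence t U) (hV : IsNormalSequence t V) :
    IsNormalSequence t fun n => U n ∩ V n where
  mem_nhds n := inter_mem (hU.mem_nhds n) (hV.mem_nhds n)
  solid n _ hx _ hy := ⟨hU.solid n hx.1 hy, hV.solid n hx.2 hy⟩
  add_mem n _ _ ha hb := ⟨hU.add_mem n _ _ ha.1 hb.1, hV.add_mem n _ _ ha.2 hb.2⟩

lemma IsLocallySolidTopology.exists_isNormalSequence [Module ℝ F] {t : TopologicalSpace F}
    (ht : IsLocallySolidTopology t) {V : Set F} (hV : V ∈ @nhds F t 0) :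
    ∃ U, IsNormalSequence t U ∧ U 0 ⊆ V := by
  have := ht.isTopologicalAddGroup
  let P := {W : Set F // W ∈ @nhds F t 0 ∧ LatticeOrderedAddCommGroup.IsSolid W}
  have hstep : ∀ W : P, ∃ W' : P, ∀ a b, a ∈ W'.1 → b ∈ W'.1 → a + b ∈ W.1 := by
    rintro ⟨W, hW, -⟩
    obtain ⟨W₁, hW₁, h⟩ := exists_nhds_zero_half hW
    obtain ⟨W₂, hW₂, hsub, hsol⟩ := ht.exists_solid W₁ hW₁
    exact ⟨⟨W₂, hW₂, hsol⟩, fun a b ha hb => h a (hsub ha) b (hsub hb)⟩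
  choose g hg using hstep
  obtain ⟨V₀, hV₀, hsub, hsol⟩ := ht.exists_solid V hV
  let U : ℕ → P := fun n => Nat.rec ⟨V₀, hV₀, hsol⟩ (fun _ W => g W) n
  exact ⟨fun n => (U n).1, ⟨fun n => (U n).2.1, fun n => (U n).2.2, fun n => hg (U n)⟩, hsub⟩

variable {t : TopologicalSpace F} {U : ℕ → Set F}

lemma IsNormalSequence.zero_mem (hU : IsNormalSequence t U) (n : ℕ) : (0 : F) ∈ U n :=
  @mem_of_mem_nhds F t _ _ (hU.mem_nhds n)

lemma IsNormalSequence.sum_mem (hU : IsNormalSequence t U) {x : ℕ → F} (hx : ∀ n, x n ∈ U n)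
    (j m : ℕ) : ∑ i ∈ Finset.range j, x (m + 1 + i) ∈ U m := by
  induction j generalizing m with
  | zero => simpa using hU.zero_mem m
  | succ j ih =>
    rw [Finset.sum_range_succ']
    refine hU.add_mem m _ _ ?_ (hx _)
    have := ih (m + 1)
    refine (congrArg (· ∈ U (m + 1)) (Finset.sum_congr rfl fun i _ => ?_)).mp this
    congr 1
    omega

variable [IsOrderedAddMonoid F]

lemma IsNormalSequence.mem_of_le (hU : IsNormalSequence t U) {n : ℕ} {a b : F} (ha : 0 ≤ a)
    (hab : a ≤ b) (hb : b ∈ U n) : a ∈ U n :=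
  hU.solid n hb (abs_le_abs_of_nonneg ha hab)

/-- By order continuity a supremum of members of `U (n + 1)` lies in its closure, hence in
`U n`. -/
lemma IsNormalSequence.mem_of_isLUB (hU : IsNormalSequence t U) (ht : IsOrderContinuousTopology t)
    {D : Set F} (hne : D.Nonempty) (hD : DirectedOn (· ≤ ·) D) {y : F} (hy : IsLUB D y) {n : ℕ}
    (hDU : D ⊆ U (n + 1)) : y ∈ U n := by
  obtain ⟨d, hd, h⟩ := ht.exists_sub_mem_of_isLUB hne hD hy (hU.mem_nhds (n + 1))
  simpa using hU.add_mem n _ _ h (hDU hd)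

end NormalSequence

section Minimality

variable {F : Type u} [NormedAddCommGroup F] [NormedSpace ℝ F] [CompleteSpace F]
    [Lattice F] [IsOrderedAddMonoid F] [IsOrderedModule ℝ F] [HasSolidNorm F]

/-- The positive elements below `u` in the kernel `⋂ n, U n` of a normal sequence have a greatest
one, the projection of `u` to this kernel. -/
lemma IsNormalSequence.exists_isGreatest
    (hF : IsOrderContinuousTopology (UniformSpace.toTopologicalSpace : TopologicalSpace F))
    {t : TopologicalSpace F} (ht : IsOrderContinuousTopology t) {U : ℕ → Set F}
    (hU : IsNormalSequence t U) {u : F} (hu : 0 ≤ u) :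
    ∃ p, IsGreatest {x | 0 ≤ x ∧ x ≤ u ∧ ∀ n, x ∈ U n} p := by
  have hne : {x | 0 ≤ x ∧ x ≤ u ∧ ∀ n, x ∈ U n}.Nonempty := ⟨0, le_rfl, hu, hU.zero_mem⟩
  have hdir : DirectedOn (· ≤ ·) {x | 0 ≤ x ∧ x ≤ u ∧ ∀ n, x ∈ U n} := by
    rintro a ⟨ha, hau, haU⟩ b ⟨hb, hbu, hbU⟩
    refine ⟨a ⊔ b, ⟨le_sup_of_le_left ha, sup_le hau hbu, fun n => ?_⟩, le_sup_left, le_sup_right⟩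
    exact hU.mem_of_le (le_sup_of_le_left ha)
      (sup_le (le_add_of_nonneg_right hb) (le_add_of_nonneg_left ha))
      (hU.add_mem n _ _ (haU _) (hbU _))
  obtain ⟨p, hp⟩ := exists_isLUB_of_directedOn hF hne hdir ⟨u, fun x hx => hx.2.1⟩
  exact ⟨p, ⟨hp.1 ⟨le_rfl, hu, hU.zero_mem⟩, hp.2 fun x hx => hx.2.1,
    fun n => hU.mem_of_isLUB ht hne hdir hp fun x hx => hx.2.2 _⟩, hp.1⟩

/-- If the projection of `u` to the kernel of a normal sequence has norm less than `ε`, then so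
have all positive elements below `u` of some member of the sequence: otherwise the order limit
superior of a sequence of counterexamples lies in the kernel and has norm at least `ε`. -/
lemma IsNormalSequence.exists_forall_norm_lt
    (hF : IsOrderContinuousTopology (UniformSpace.toTopologicalSpace : TopologicalSpace F))
    {t : TopologicalSpace F} (ht : IsOrderContinuousTopology t) {U : ℕ → Set F}
    (hU : IsNormalSequence t U) {u p : F} {ε : ℝ}
    (hp : IsGreatest {x | 0 ≤ x ∧ x ≤ u ∧ ∀ n, x ∈ U n} p) (hpε : ‖p‖ < ε) :
    ∃ n, ∀ x ∈ U n, 0 ≤ x → x ≤ u → ‖x‖ < ε := by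
  by_contra! H
  choose x hxU hx0 hxu hxε using H
  obtain ⟨y, z, hy, hxy, hyu, hz0, hzy, hlim⟩ := exists_limsup hF hx0 hxu
  have hyU : ∀ m, y (m + 2) ∈ U m := fun m => by
    refine hU.mem_of_isLUB ht (Set.range_nonempty _)
      (partialSups_monotone _).directed_le.directedOn_range (hy (m + 2)) ?_
    rintro _ ⟨n, rfl⟩
    exact hU.mem_of_le ((hx0 (m + 2)).trans
      (le_partialSups_of_le (fun i => x (m + 2 + i)) (Nat.zero_le n)))
      (partialSups_le_sum (fun i => hx0 _) n) (hU.sum_mem hxU (n + 1) (m + 1))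
  have hzp : z ≤ p := hp.2 ⟨hz0, (hzy 0).trans (hyu 0), fun n =>
    hU.mem_of_le hz0 (hzy (n + 2)) (hyU n)⟩
  obtain ⟨N, hN⟩ := hlim (ε - ‖p‖) (sub_pos.2 hpε)
  have h1 : ε ≤ ‖y N‖ := (hxε N).trans (norm_le_norm_of_nonneg_of_le (hx0 N) (hxy N))
  have h2 := norm_le_norm_of_nonneg_of_le hz0 hzp
  have h3 := norm_sub_norm_le (y N) z
  linarith [hN N le_rfl]

/-- On order intervals every Hausdorff order continuous locally solid topology is at least as
strong as the norm topology. The projections of `u` to the kernels of normal sequences decrease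
to zero, since their infimum lies in every neighborhood of zero, so that one of them has small
norm. -/
lemma exists_nhds_forall_norm_lt
    (hF : IsOrderContinuousTopology (UniformSpace.toTopologicalSpace : TopologicalSpace F))
    {t : TopologicalSpace F} (ht : t ∈ hausdorffOrderContinuousTopologies F)
    {u : F} (hu : 0 ≤ u) {ε : ℝ} (hε : 0 < ε) :
    ∃ W ∈ @nhds F t 0, LatticeOrderedAddCommGroup.IsSolid W ∧
      ∀ x ∈ W, 0 ≤ x → x ≤ u → ‖x‖ < ε := by
  obtain ⟨hT2, hoc, hls⟩ := ht
  suffices h : ∃ p ∈ {p | ∃ U, IsNormalSequence t U ∧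
      IsGreatest {x | 0 ≤ x ∧ x ≤ u ∧ ∀ n, x ∈ U n} p}, p ∈ Metric.ball (0 : F) ε by
    obtain ⟨p, ⟨U, hU, hp⟩, hpε⟩ := h
    obtain ⟨n, hn⟩ := hU.exists_forall_norm_lt hF hoc hp (mem_ball_zero_iff.1 hpε)
    exact ⟨U n, hU.mem_nhds n, hU.solid n, hn⟩
  refine hF.exists_mem_of_isGLB ?_ ?_ ⟨?_, fun w hw => ?_⟩ (Metric.ball_mem_nhds 0 hε)
  · obtain ⟨U, hU, -⟩ := hls.exists_isNormalSequence univ_mem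
    obtain ⟨p, hp⟩ := hU.exists_isGreatest hF hoc hu
    exact ⟨p, U, hU, hp⟩
  · rintro p ⟨U, hU, hp⟩ q ⟨V, hV, hq⟩
    obtain ⟨r, hr⟩ := (hU.inter hV).exists_isGreatest hF hoc hu
    exact ⟨r, ⟨_, hU.inter hV, hr⟩,
      hp.2 ⟨hr.1.1, hr.1.2.1, fun n => (hr.1.2.2 n).1⟩,
      hq.2 ⟨hr.1.1, hr.1.2.1, fun n => (hr.1.2.2 n).2⟩⟩
  · rintro p ⟨U, hU, hp⟩
    exact hp.1.1
  · have hw0 : w⁺ = 0 := by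
      by_contra hne
      have hV : {w⁺}ᶜ ∈ @nhds F t 0 := compl_singleton_mem_nhds (Ne.symm hne)
      obtain ⟨U, hU, hUV⟩ := hls.exists_isNormalSequence hV
      obtain ⟨p, hp⟩ := hU.exists_isGreatest hF hoc hu
      exact hUV (hU.mem_of_le (posPart_nonneg w)
        (sup_le (hw ⟨U, hU, hp⟩) hp.1.1) (hp.1.2.2 0)) rfl
    exact posPart_eq_zero.1 hw0

/-- The unbounded norm topology is the weakest Hausdorff order continuous locally solid topology
on a Banach lattice with order continuous norm. -/
theorem isGreatest_unTopology
    (hF : IsOrderContinuousTopology (UniformSpace.toTopologicalSpace : TopologicalSpace F)) :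
    IsGreatest (hausdorffOrderContinuousTopologies F) (unTopology F) := by
  refine ⟨unTopology_mem_hausdorffOrderContinuousTopologies hF, fun t ht => ?_⟩
  refine le_of_nhds_le_nhds fun x V hV => ?_
  obtain ⟨u, ε, hu, hε, hV⟩ := mem_nhds_unTopology.1 hV
  obtain ⟨W, hW, hsol, hWε⟩ := exists_nhds_forall_norm_lt hF ht hu hε
  have := ht.2.2.isTopologicalAddGroup
  have hsub : Tendsto (fun f => f - x) (@nhds F t x) (@nhds F t 0) := by
    have : Continuous[t, t] fun f => f - x := continuous_sub_right x
    simpa using this.tendsto x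
  filter_upwards [hsub hW] with f hf
  refine hV f (hWε _ (hsol hf ?_) (le_inf (abs_nonneg _) hu) inf_le_right)
  rw [abs_of_nonneg (le_inf (abs_nonneg _) hu)]
  exact inf_le_left

theorem tauTopology_eq_unTopology
    (hF : IsOrderContinuousTopology (UniformSpace.toTopologicalSpace : TopologicalSpace F)) :
    tauTopology F = unTopology F :=
  (isGreatest_unTopology hF).isLUB.sSup_eq

end Minimality

/-! ### Dispersed subspaces -/

section Dispersed

variable {F : Type u} [NormedAddCommGroup F] [NormedSpace ℝ F]

lemma AgreesWithNormOn.agreesWithNormOnSequences {t : TopologicalSpace F} {E : Submodule ℝ F}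
    (h : AgreesWithNormOn t E) : AgreesWithNormOnSequences t E := by
  intro e x
  have key : ∀ s : TopologicalSpace F, Tendsto (fun n => (e n : F)) atTop (@nhds F s x) ↔
      Tendsto e atTop (@nhds E (TopologicalSpace.induced (↑) s) x) := fun s => by
    rw [nhds_induced, tendsto_comap_iff]
    rfl
  rw [← tendsto_iff_norm_sub_tendsto_zero, key, key, h]

variable [Lattice F] [IsOrderedAddMonoid F] [IsOrderedModule ℝ F]

lemma IsNDispersed.isDispersed {E : Submodule ℝ F} {n : ℕ} (h : IsNDispersed n E) :
    IsDispersed E := by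
  obtain ⟨r, hr, h⟩ := h
  rintro ⟨e, f, heE, he1, hfd, hlim⟩
  refine h ?_
  have hs : 0 < min (1 / 2) (r / 2) := lt_min (by norm_num) (half_pos hr)
  obtain ⟨M, hM⟩ := eventually_atTop.1 (hlim.eventually (gt_mem_nhds hs))
  have hf : ∀ k ≥ M, 1 / 2 < ‖f k‖ ∧ ‖f k - e k‖ < r / 2 := fun k hk => by
    have h1 := hM k hk
    have h2 := norm_sub_norm_le (e k) (f k)
    rw [he1, norm_sub_rev] at h2
    exact ⟨by linarith [h1.trans_le (min_le_left _ _)], h1.trans_le (min_le_right _ _)⟩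
  have hpos : ∀ k : Fin n, 0 < ‖f (M + k)‖ := fun k =>
    lt_trans (by norm_num) (hf _ (Nat.le_add_right M k)).1
  refine ⟨fun k => ‖f (M + k)‖⁻¹ • f (M + k), fun i j hij => ?_, fun k => ?_, fun k => ?_⟩
  · have hne : M + (i : ℕ) ≠ M + j := fun h => hij (Fin.ext (by omega))
    exact abs_smul_inf_abs_smul_eq_zero _ _ (hfd hne)
  · rw [norm_smul, norm_inv, norm_norm, inv_mul_cancel₀ (hpos k).ne']
  · obtain ⟨h1, h2⟩ := hf _ (Nat.le_add_right M k)
    refine (Metric.infDist_le_dist_of_mem (E.smul_mem ‖f (M + k)‖⁻¹ (heE (M + k)))).trans_lt ?_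
    rw [dist_eq_norm, ← smul_sub, norm_smul, norm_inv, norm_norm, inv_mul_lt_iff₀ (hpos k)]
    nlinarith

variable [HasSolidNorm F] [CompleteSpace F]

/-- The Kadec–Pełczyński disjointification. If on `E` the unbounded norm topology does not control
the norm, normalized `e n` in `E` can be chosen successively with
`|e n| ⊓ 4 ^ n • ∑ j < n, |e j|` small. With `X = ∑ j, 2⁻ʲ • |e j|` the positive elements
`(|e n| - 4 ^ n • ∑ j < n, |e j| - 2⁻ⁿ • X)⁺` are pairwise disjoint, and close to `|e n|`. -/
lemma not_isDispersed_of_forall_exists {E : Submodule ℝ F} {a : ℝ} (ha : 0 < a)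
    (H : ∀ u : F, 0 ≤ u → ∀ δ > 0, ∃ e ∈ E, a ≤ ‖e‖ ∧ ‖|e| ⊓ u‖ < δ) : ¬ IsDispersed E := by
  have H1 : ∀ (u : {u : F // 0 ≤ u}) (n : ℕ),
      ∃ e ∈ E, ‖e‖ = 1 ∧ ‖|e| ⊓ u.1‖ < (1 / 2) ^ n := by
    rintro ⟨u, hu⟩ n
    have hd : 0 < max a⁻¹ 1 := lt_max_of_lt_right one_pos
    obtain ⟨e, heE, hea, heu⟩ := H u hu ((1 / 2) ^ n / max a⁻¹ 1) (by positivity)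
    have he : 0 < ‖e‖ := ha.trans_le hea
    refine ⟨‖e‖⁻¹ • e, E.smul_mem _ heE, ?_, ?_⟩
    · rw [norm_smul, norm_inv, norm_norm, inv_mul_cancel₀ he.ne']
    · have hc : |‖e‖⁻¹| ≤ max a⁻¹ 1 := by
        rw [abs_of_pos (inv_pos.2 he)]
        exact le_max_of_le_left (inv_anti₀ ha hea)
      have h := norm_le_norm_of_nonneg_of_le (le_inf (abs_nonneg _) hu)
        (abs_smul_inf_le hc (le_max_right _ _) e hu)
      rw [norm_smul, Real.norm_of_nonneg hd.le] at h
      rw [lt_div_iff₀' hd] at heu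
      exact h.trans_lt heu
  choose g hgE hg1 hgu using H1
  have h4 : ∀ n, (0 : ℝ) ≤ 4 ^ n := fun n => by positivity
  let T : {u : F // 0 ≤ u} → ℕ → {u : F // 0 ≤ u} := fun u n =>
    ⟨(4 : ℝ) ^ n • u.1, smul_nonneg (h4 n) u.2⟩
  -- `S n` is the sum of the `|e j|` with `j < n`
  let S : ℕ → {u : F // 0 ≤ u} := fun n => Nat.rec ⟨0, le_rfl⟩
    (fun n u => ⟨u.1 + |g (T u n) n|, add_nonneg u.2 (abs_nonneg _)⟩) n
  let e : ℕ → F := fun n => g (T (S n) n) n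
  have hS : ∀ n, (S (n + 1)).1 = (S n).1 + |e n| := fun n => rfl
  have he1 : ∀ n, ‖e n‖ = 1 := fun n => hg1 _ _
  have heS : ∀ n, ‖|e n| ⊓ (4 : ℝ) ^ n • (S n).1‖ < (1 / 2) ^ n := fun n => hgu _ _
  have hle : ∀ m n, m < n → |e m| ≤ (S n).1 := by
    intro m n hmn
    induction n, hmn using Nat.le_induction with
    | base => rw [hS]; exact le_add_of_nonneg_left (S m).2
    | succ n _ ih => rw [hS]; exact ih.trans (le_add_of_nonneg_right (abs_nonneg _))
  have hnn : ∀ n, 0 ≤ (1 / 2 : ℝ) ^ n • |e n| := fun n =>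
    smul_nonneg (by positivity) (abs_nonneg _)
  have hsum : Summable fun n => (1 / 2 : ℝ) ^ n • |e n| := by
    refine Summable.of_norm_bounded summable_geometric_two fun n => ?_
    rw [norm_smul, norm_abs_eq_norm, he1, mul_one, Real.norm_of_nonneg (by positivity)]
  set X : F := ∑' n, (1 / 2 : ℝ) ^ n • |e n|
  have hX : ∀ n, (1 / 2 : ℝ) ^ n • |e n| ≤ X := fun n =>
    hsum.le_tsum n fun m _ => hnn m
  have hX0 : 0 ≤ X := (hnn 0).trans (hX 0)
  have hSn : ∀ n, 0 ≤ (4 : ℝ) ^ n • (S n).1 := fun n => smul_nonneg (h4 n) (S n).2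
  have hXn : ∀ n : ℕ, 0 ≤ (1 / 2 : ℝ) ^ n • X := fun n => smul_nonneg (by positivity) hX0
  choose f hf hfe using fun n =>
    exists_abs_le_posPart_sub (e n) (add_nonneg (hSn n) (hXn n))
  have hdis : ∀ m n, m < n → |f m| ⊓ |f n| = 0 := by
    intro m n hmn
    rw [inf_comm]
    refine abs_inf_abs_eq_zero_of_le
      ((hf n).trans (posPart_mono (sub_le_sub_left ?_ _)))
      ((hf m).trans (posPart_mono (sub_le_sub_left ?_ _)))
      (posPart_sub_smul_inf_le_zero (x := |e n|) (y := |e m|) (one_le_pow₀ (by norm_num) :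
        (1 : ℝ) ≤ 4 ^ n))
    · exact (smul_le_smul_of_nonneg_left (hle m n hmn) (h4 n)).trans
        (le_add_of_nonneg_right (hXn n))
    -- `4⁻ⁿ ≤ 2⁻ᵐ 2⁻ⁿ`, and `2⁻ⁿ • |e n|` is a term of the series `X`
    · calc ((4 : ℝ) ^ n)⁻¹ • |e n| ≤ ((1 / 2 : ℝ) ^ m * (1 / 2) ^ n) • |e n| := by
            refine smul_le_smul_of_nonneg_right ?_ (abs_nonneg _)
            calc ((4 : ℝ) ^ n)⁻¹ = (1 / 2) ^ n * (1 / 2) ^ n := by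
                  rw [← mul_pow, ← inv_pow]; norm_num
              _ ≤ (1 / 2) ^ m * (1 / 2) ^ n :=
                  mul_le_mul_of_nonneg_right
                    (pow_le_pow_of_le_one (by norm_num) (by norm_num) hmn.le) (by positivity)
        _ = (1 / 2 : ℝ) ^ m • (1 / 2 : ℝ) ^ n • |e n| := mul_smul _ _ _
        _ ≤ (1 / 2 : ℝ) ^ m • X := smul_le_smul_of_nonneg_left (hX n) (by positivity)
        _ ≤ _ := le_add_of_nonneg_left (hSn m)
  refine not_not.2 ⟨e, f, fun n => hgE _ _, he1, fun m n hmn => ?_, ?_⟩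
  · rcases lt_or_gt_of_ne hmn with h | h
    · exact hdis m n h
    · rw [inf_comm]; exact hdis n m h
  · have hlim : Tendsto (fun n : ℕ => (1 / 2 : ℝ) ^ n * (1 + ‖X‖)) atTop (𝓝 0) := by
      simpa using (tendsto_pow_atTop_nhds_zero_of_lt_one (r := (1 / 2 : ℝ))
        (by norm_num) (by norm_num)).mul_const (1 + ‖X‖)
    refine squeeze_zero (fun n => norm_nonneg _) (fun n => ?_) hlim
    have h1 : |f n - e n| ≤ |e n| ⊓ (4 : ℝ) ^ n • (S n).1 + (1 / 2 : ℝ) ^ n • X :=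
      (hfe n).trans ((inf_add_le_inf_add_inf (abs_nonneg _) (hSn n) (hXn n)).trans
        (add_le_add le_rfl inf_le_right))
    calc ‖f n - e n‖ = ‖|f n - e n|‖ := (norm_abs_eq_norm _).symm
      _ ≤ ‖|e n| ⊓ (4 : ℝ) ^ n • (S n).1 + (1 / 2 : ℝ) ^ n • X‖ :=
          norm_le_norm_of_nonneg_of_le (abs_nonneg _) h1
      _ ≤ ‖|e n| ⊓ (4 : ℝ) ^ n • (S n).1‖ + ‖(1 / 2 : ℝ) ^ n • X‖ := norm_add_le _ _
      _ ≤ (1 / 2) ^ n + (1 / 2) ^ n * ‖X‖ := by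
          rw [norm_smul, Real.norm_of_nonneg (by positivity : (0 : ℝ) ≤ (1 / 2) ^ n)]
          exact add_le_add (heS n).le le_rfl
      _ = (1 / 2) ^ n * (1 + ‖X‖) := by ring

/-- If `E` is not `n`-dispersed for any `n`, then near `E` there are arbitrarily long disjoint
families of normalized elements. One member of such a family is almost disjoint from a given `u`,
and so is an element of `E` close to it. -/
lemma IsDispersed.exists_isNDispersed
    (hF : IsOrderContinuousTopology (UniformSpace.toTopologicalSpace : TopologicalSpace F))
    {E : Submodule ℝ F} (hE : IsDispersed E) : ∃ n : ℕ, 2 ≤ n ∧ IsNDispersed n E := by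
  by_contra! H
  refine not_isDispersed_of_forall_exists (a := 1 / 2) (by norm_num) (fun u hu δ hδ => ?_) hE
  obtain ⟨N, hN2, hN⟩ := exists_norm_abs_inf_lt hF hu (half_pos hδ)
  have hr : 0 < min (1 / 2) (δ / 2) := lt_min (by norm_num) (half_pos hδ)
  obtain ⟨f, hfd, hf1, hfE⟩ := not_not.1 fun h => H N hN2 ⟨_, hr, h⟩
  obtain ⟨k, hk⟩ := hN f hfd
  obtain ⟨e, heE, hfe⟩ := (Metric.infDist_lt_iff ⟨0, E.zero_mem⟩).1 (hfE k)
  rw [dist_eq_norm] at hfe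
  refine ⟨e, heE, ?_, ?_⟩
  · have := norm_sub_norm_le (f k) e
    rw [hf1] at this
    linarith [hfe.trans_le (min_le_left _ _)]
  · have h1 : |e| ⊓ u ≤ |f k| ⊓ u + |f k - e| := by
      have h := abs_add_inf_le (f k) (e - f k) hu
      rw [add_sub_cancel, abs_sub_comm] at h
      exact h.trans (add_le_add le_rfl inf_le_left)
    have h2 := norm_le_norm_of_nonneg_of_le (le_inf (abs_nonneg _) hu) h1
    have h3 := norm_add_le (|f k| ⊓ u) |f k - e|
    rw [norm_abs_eq_norm] at h3
    linarith [hfe.trans_le (min_le_right _ _)]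

/-- On a dispersed subspace the unbounded norm topology controls the norm. -/
lemma IsDispersed.agreesWithNormOn {E : Submodule ℝ F} (hE : IsDispersed E) :
    AgreesWithNormOn (unTopology F) E := by
  have H : ∀ ε > 0, ∃ u : F, 0 ≤ u ∧ ∃ δ > 0, ∀ e ∈ E, ‖|e| ⊓ u‖ < δ → ‖e‖ < ε := by
    by_contra! H
    obtain ⟨ε, hε, H⟩ := H
    refine not_isDispersed_of_forall_exists hε (fun u hu δ hδ => ?_) hE
    obtain ⟨e, he, heu, hee⟩ := H u hu δ hδ
    exact ⟨e, he, hee, heu⟩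
  refine le_antisymm ?_ (induced_mono (le_of_nhds_le_nhds unTopology_nhds_le))
  refine le_of_nhds_le_nhds fun x => ?_
  rw [@nhds_induced _ _ (unTopology F), nhds_induced]
  rintro V ⟨W, hW, hWV⟩
  obtain ⟨ε, hε, hball⟩ := Metric.mem_nhds_iff.1 hW
  obtain ⟨u, hu, δ, hδ, h⟩ := H ε hε
  refine ⟨{f | ‖|f - x| ⊓ u‖ < δ}, mem_nhds_unTopology.2 ⟨u, δ, hu, hδ, fun f hf => hf⟩,
    fun y hy => hWV (hball ?_)⟩
  exact mem_ball_iff_norm.2 (h _ (E.sub_mem y.2 x.2) hy)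

/-- An almost disjoint normalized sequence in `E` converges to zero in the unbounded norm topology,
but not in norm. -/
lemma AgreesWithNormOnSequences.isDispersed
    (hF : IsOrderContinuousTopology (UniformSpace.toTopologicalSpace : TopologicalSpace F))
    {E : Submodule ℝ F} (h : AgreesWithNormOnSequences (unTopology F) E) : IsDispersed E := by
  rintro ⟨e, f, heE, he1, hfd, hlim⟩
  have hun : Tendsto (fun n => e n) atTop (@nhds F (unTopology F) 0) := by
    refine tendsto_unTopology_iff.2 fun u hu => ?_
    refine squeeze_zero (fun n => norm_nonneg _) (fun n => ?_)
      (by simpa using (hfd.tendsto_norm_abs_inf hF hu).add hlim)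
    have h1 : |e n - 0| ⊓ u ≤ |f n| ⊓ u + |f n - e n| := by
      have h := abs_add_inf_le (f n) (e n - f n) hu
      rw [add_sub_cancel, abs_sub_comm] at h
      rw [sub_zero]
      exact h.trans (add_le_add le_rfl inf_le_left)
    refine (norm_le_norm_of_nonneg_of_le (le_inf (abs_nonneg _) hu) h1).trans ?_
    rw [← norm_abs_eq_norm (f n - e n)]
    exact norm_add_le _ _
  have := (h (fun n => ⟨e n, heE n⟩) 0).1 hun
  simp [he1] at this

end Dispersed

theorem mainTheorem2 {F : Type u} [NormedAddCommGroup F] [NormedSpace ℝ F] [CompleteSpace F]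
    [Lattice F] [IsOrderedAddMonoid F] [IsOrderedModule ℝ F] [HasSolidNorm F]
    (hF : IsOrderContinuousTopology (UniformSpace.toTopologicalSpace : TopologicalSpace F))
    (E : Submodule ℝ F) (hE : IsClosed (E : Set F)) :
    IsGreatest (hausdorffOrderContinuousTopologies F) (tauTopology F) ∧
    [ IsDispersed E,
      ∃ n : ℕ, 2 ≤ n ∧ IsNDispersed n E,
      AgreesWithNormOn (tauTopology F) E,
      AgreesWithNormOnSequences (tauTopology F) E ].TFAE := by
  rw [tauTopology_eq_unTopology hF]
  refine ⟨isGreatest_unTopology hF, ?_⟩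
  tfae_have 1 → 2 := fun h => h.exists_isNDispersed hF
  tfae_have 2 → 1 := fun ⟨_, _, h⟩ => h.isDispersed
  tfae_have 1 → 3 := fun h => h.agreesWithNormOn
  tfae_have 3 → 4 := fun h => h.agreesWithNormOnSequences
  tfae_have 4 → 1 := fun h => h.isDispersed hF
  tfae_finish
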